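/- For every sample size $n$ let $U_n=\{1,\dots,n\}$ be a sample of $n$ units with fixed real potential outcomes $y_i(\mathbf z)$, $i\in U_n$, $\mathbf z\in\{0,1\}^n$; write $y_i(z;\mathbf z_{-i})$ for the outcome of $i$ when its own treatment is $z$ and the others' treatments are $\mathbf z_{-i}$. The samples for different $n$ need not be related, and the dependence on $n$ is left implicit. The random assignment $\mathbf Z=(Z_1,\dots,Z_n)$ is drawn by complete randomization: for a fixed $p\in(0,1)$ and $m=\lfloor pn\rfloor$, $\Pr(\mathbf Z=\mathbf z)=\binom nm^{-1}$ if $\sum_i z_i=m$, and $0$ otherwise. Put $p_i=\Pr(Z_i=1)$, $Y_i=y_i(\mathbf Z)$, and $$\tau_{\mathrm{EATE}}=\mathbb E\Big[\frac1n\sum_{i=1}^n\big(y_i(1;\mathbf Z_{-i})-y_i(0;\mathbf Z_{-i})\big)\Big],$$ $$\hat\tau_{\mathrm{HT}}=\frac1n\sum_{i=1}^n\frac{Z_iY_i}{p_i}-\frac1n\sum_{i=1}^n\frac{(1-Z_i)Y_i}{1-p_i},\qquad \hat\tau_{\mathrm{HA}}=\frac{\sum_{i} Z_iY_i/p_i}{\sum_{i}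 Z_i/p_i}-\frac{\sum_{i}(1-Z_i)Y_i/(1-p_i)}{\sum_{i}(1-Z_i)/(1-p_i)}.$$ Let $I_{ij}=1$ if $i=j$ or if $y_j(\mathbf z)\ne y_j(\mathbf z')$ for some $\mathbf z,\mathbf z'\in\{0,1\}^n$ that agree in all coordinates other than $i$, and $I_{ij}=0$ otherwise. Let $d_{ij}=1$ if $I_{\ell i}I_{\ell j}=1$ for some $\ell\in U_n$, and $d_{ij}=0$ otherwise. Put $d_{\mathrm{avg}}=\frac1n\sum_{i,j}d_{ij}$ and $c_{\mathrm{avg}}=\frac1n\sum_{i,j}I_{ij}$. Assume that there are constants $0<k<\infty$, $q\ge2$, $s\ge1$ such that, for all sufficiently large $n$ and all $i\in U_n$, $z\in\{0,1\}$: $k^{-1}\le p_i\le1-k^{-1}$, $\mathbb E|Y_i|^q\le k^q$ and $\mathbb E|y_i(z;\mathbf Z_{-i})|^s\le k^s$. If $d_{\mathrm{avg}}=o(n)$ and $c_{\mathrm{avg}}=o(n^{1/2})$, then: (i) $\hat\tau_{\mathrm{HA}}=\hat\tau_{\mathrm{HT}}$ with probability one for every $n$ with $m\ge1$; (ii) $\hat\tau_{\mathrm{HT}}-\tau_{\mathrm{EATE}}\to0$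 and $\hat\tau_{\mathrm{HA}}-\tau_{\mathrm{EATE}}\to0$ in probability as $n\to\infty$; (iii) $\hat\tau_{\mathrm{HT}}-\tau_{\mathrm{EATE}}=O_p\big(n^{-1/2}d_{\mathrm{avg}}^{1/2}+n^{-1/2}c_{\mathrm{avg}}\big)$ and $\hat\tau_{\mathrm{HA}}-\tau_{\mathrm{EATE}}=O_p\big(n^{-1/2}d_{\mathrm{avg}}^{1/2}+n^{-1/2}c_{\mathrm{avg}}\big)$. -/

import Mathlib

open MeasureTheory Filter Asymptotics
open scoped ENNReal Topology

namespace Interference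

/-- Treatment assignments of a sample of `n` units; `true` means treated (`z_i = 1`). -/
abbrev Assignment (n : ℕ) : Type := Fin n → Bool

/-- Potential outcomes of a sample of `n` units: `y i z` is the outcome of unit `i` under the
full assignment `z`.  The outcome `y_i(b; z_{-i})` is `y i (Function.update z i b)`. -/
abbrev Outcomes (n : ℕ) : Type := Fin n → Assignment n → ℝ

/-! ### Interference -/

section Structure

variable {n : ℕ} (y : Outcomes n)

/-- Unit `i` interferes with unit `j`: changing only the treatment of `i` changes the outcome of `j`
under at least one assignment, or `i = j`. -/
def Interferes (i j : Fin n) : Prop :=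
  (∃ z z' : Assignment n, (∀ l, l ≠ i → z l = z' l) ∧ y j z ≠ y j z') ∨ i = j

/-- Units `i` and `j` are interference dependent: some unit interferes with both. -/
def InterferenceDependent (i j : Fin n) : Prop :=
  ∃ l : Fin n, Interferes y l i ∧ Interferes y l j

open Classical in
/-- The average interference dependence `d_avg = n⁻¹ ∑ i, ∑ j, d_ij`. -/
noncomputable def dAvg : ℝ :=
  (1 / (n : ℝ)) * ∑ i : Fin n, ∑ j : Fin n, if InterferenceDependent y i j then 1 else 0

open Classical in
/-- The number `c_i` of units that unit `i` interferes with (itself included). -/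
noncomputable def interferenceCount (i : Fin n) : ℝ :=
  ∑ j : Fin n, if Interferes y i j then 1 else 0

/-- The average interference count `c_avg = n⁻¹ ∑ i, c_i`. -/
noncomputable def cAvg : ℝ :=
  (1 / (n : ℝ)) * ∑ i : Fin n, interferenceCount y i

/-- The assignment-conditional average treatment effect
`τ_ATE(z) = n⁻¹ ∑ i, (y_i(1; z_{-i}) - y_i(0; z_{-i}))`. -/
noncomputable def ate (z : Assignment n) : ℝ :=
  (1 / (n : ℝ)) * ∑ i : Fin n,
    (y i (Function.update z i true) - y i (Function.update z i false))

end Structure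

/-! ### Design, estimand, estimators -/

section Design

variable {n : ℕ} {Ω : Type*} [MeasurableSpace Ω]

/-- The random vector `Z` has the complete randomization design with `m` treated units. -/
def IsCompleteRandomization (μ : Measure Ω) (Z : Ω → Assignment n) (m : ℕ) : Prop :=
  ∀ z : Assignment n,
    μ.real {ω | Z ω = z} = if ∑ i, (z i).toNat = m then ((n.choose m : ℕ) : ℝ)⁻¹ else 0

/-- The marginal treatment probability `p_i = Pr(Z_i = 1)`. -/
noncomputable def treatProb (μ : Measure Ω) (Z : Ω → Assignment n) (i : Fin n) : ℝ :=
  μ.real {ω | Z ω i = true}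

/-- The expected average treatment effect `τ_EATE = E[τ_ATE(Z)]`. -/
noncomputable def eate (μ : Measure Ω) (Z : Ω → Assignment n) (y : Outcomes n) : ℝ :=
  ∫ ω, ate y (Z ω) ∂μ

/-- The indicator `Z_i`, as a real random variable. -/
noncomputable def treated (Z : Ω → Assignment n) (i : Fin n) (ω : Ω) : ℝ :=
  ((Z ω i).toNat : ℝ)

/-- The observed outcome `Y_i = y_i(Z)`. -/
def observed (Z : Ω → Assignment n) (y : Outcomes n) (i : Fin n) (ω : Ω) : ℝ :=
  y i (Z ω)

/-- The Horvitz-Thompson estimator. -/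
noncomputable def htEst (μ : Measure Ω) (Z : Ω → Assignment n) (y : Outcomes n) (ω : Ω) : ℝ :=
  (1 / (n : ℝ)) * ∑ i, treated Z i ω * observed Z y i ω / treatProb μ Z i
    - (1 / (n : ℝ)) * ∑ i, (1 - treated Z i ω) * observed Z y i ω / (1 - treatProb μ Z i)

/-- The Hájek estimator. -/
noncomputable def hajekEst (μ : Measure Ω) (Z : Ω → Assignment n) (y : Outcomes n) (ω : Ω) : ℝ :=
  (∑ i, treated Z i ω * observed Z y i ω / treatProb μ Z i)
      / (∑ i, treated Z i ω / treatProb μ Z i)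
    - (∑ i, (1 - treated Z i ω) * observed Z y i ω / (1 - treatProb μ Z i))
      / (∑ i, (1 - treated Z i ω) / (1 - treatProb μ Z i))

/-- The regularity conditions on one sample with constants `k`, `q`, `s`: probabilistic assignment,
bounded moments of the observed outcomes, bounded moments of the potential outcomes. -/
structure Regular (μ : Measure Ω) (Z : Ω → Assignment n) (y : Outcomes n) (k q s : ℝ) : Prop where
  prob : ∀ i, k⁻¹ ≤ treatProb μ Z i ∧ treatProb μ Z i ≤ 1 - k⁻¹
  outcome : ∀ i, ∫ ω, |observed Z y i ω| ^ q ∂μ ≤ k ^ q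
  potential : ∀ (i : Fin n) (b : Bool), ∫ ω, |y i (Function.update (Z ω) i b)| ^ s ∂μ ≤ k ^ s

end Design

/-! ### Stochastic order symbols

The `n`-th random variable lives on its own probability space. -/

section Order

variable {Ω : ℕ → Type*} [∀ n, MeasurableSpace (Ω n)]

/-- `X_n = O_p(a_n)`. -/
def IsBigOInProb (μ : ∀ n, Measure (Ω n)) (X : ∀ n, Ω n → ℝ) (a : ℕ → ℝ) : Prop :=
  ∀ ε : ℝ, 0 < ε → ∃ M : ℝ, 0 < M ∧ ∀ᶠ n in atTop, (μ n).real {ω | M * a n < |X n ω|} ≤ ε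

/-- `X_n` converges to zero in probability. -/
def TendstoZeroInProb (μ : ∀ n, Measure (Ω n)) (X : ∀ n, Ω n → ℝ) : Prop :=
  ∀ ε : ℝ, 0 < ε → Tendsto (fun n => (μ n).real {ω | ε ≤ |X n ω|}) atTop (𝓝 0)

end Order

end Interference

/-! Under complete randomization every unit is treated with probability m/n, and the number treated
is almost surely m. Both Hájek denominators therefore equal n almost surely and the two estimators
coincide, so everything reduces to Horvitz-Thompson.

Its error is an average of terms e_i (`unitError`), each a function of the treatments in N_i, the
set of units interfering with i. The mean squared error is n⁻² ∑ E[e_i e_j]. If i and j are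
interference dependent, second moments bound the term, and such pairs contribute O(d_avg/n).
Otherwise N_i and N_j are disjoint, and the dependence created by the fixed treated count must be
controlled.

This is done by `abs_crExpect_mul_sub_le`: functions of disjoint sets A, B have covariance
O(|A||B|/n). The probability of a pattern on B given one on A is a draw from an urn depleted by |A|
units, and returning one unit changes it by a relative O(|B|/n). Applied to Z_i and y_i(b; Z_{-i}),
the same bound gives |E e_i| = O(|N_i|/n). Hence an independent pair contributes O(|N_i||N_j|/n).
Since ∑ |N_i| = n c_avg, these pairs add O(c_avg²/n) in `exists_mse_le`. Markov's inequality gives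
the rate, and the rate tends to zero. -/

namespace Interference

/-! ### Urn probabilities and their stability -/

open Finset in
/-- The number of assignments with `m` treated units that agree with `w` on `S`. -/
theorem card_filter_eqOn {n m l : ℕ} (hn : m + l = n) (S : Finset (Fin n)) (w : Assignment n)
    (ht : #{i ∈ S | w i = true} ≤ m) (hf : #{i ∈ S | w i = false} ≤ l) :
    #{z : Assignment n | ∑ i, (z i).toNat = m ∧ ∀ i ∈ S, z i = w i}
      = (m - #{i ∈ S | w i = true} + (l - #{i ∈ S | w i = false})).choose
          (m - #{i ∈ S | w i = true}) := by
  have hsplit : #{i ∈ S | w i = true} + #{i ∈ S | w i = false} = #S := by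
    rw [← Finset.card_filter_add_card_filter_not (s := S) (fun i => w i = true)]
    simp
  have hcompl : #Sᶜ = m - #{i ∈ S | w i = true} + (l - #{i ∈ S | w i = false}) := by
    rw [card_compl, Fintype.card_fin]; omega
  have hsum : ∀ z : Assignment n, ∑ i, (z i).toNat
      = #{i ∈ S | z i = true} + #{i ∈ Sᶜ | z i = true} := by
    intro z
    rw [← Finset.sum_add_sum_compl S, card_filter, card_filter]
    congr 1 <;> exact sum_congr rfl fun i _ => by cases z i <;> rfl
  rw [← hcompl, ← card_powersetCard]
  -- Once fixed on `S`, an assignment is determined by its treated set outside `S`, whose size is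
  -- forced.
  refine card_nbij' (fun z => {i ∈ Sᶜ | z i = true})
    (fun T i => if i ∈ S then w i else decide (i ∈ T)) ?_ ?_ ?_ ?_
  · intro z hz
    simp only [coe_filter, mem_univ, true_and, Set.mem_ofPred_eq] at hz
    obtain ⟨hz1, hz2⟩ := hz
    rw [hsum] at hz1
    have : #{i ∈ S | z i = true} = #{i ∈ S | w i = true} := by
      congr 1; exact filter_congr fun i hi => by rw [hz2 i hi]
    simp only [mem_coe, mem_powersetCard]
    exact ⟨filter_subset _ _, by omega⟩
  · intro T hT
    simp only [mem_coe, mem_powersetCard] at hT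
    obtain ⟨hT1, hT2⟩ := hT
    simp only [coe_filter, mem_univ, true_and, Set.mem_ofPred_eq]
    refine ⟨?_, fun i hi => by simp [hi]⟩
    rw [hsum]
    have h1 : ({i ∈ S | (if i ∈ S then w i else decide (i ∈ T)) = true} : Finset (Fin n))
        = {i ∈ S | w i = true} := filter_congr fun i hi => by simp [hi]
    have h2 : ({i ∈ Sᶜ | (if i ∈ S then w i else decide (i ∈ T)) = true} : Finset (Fin n))
        = T := by
      ext i
      simp only [mem_filter, mem_compl]
      constructor
      · rintro ⟨hi, h⟩; simpa [hi] using h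
      · intro hi
        have := hT1 hi
        rw [mem_compl] at this
        exact ⟨this, by simp [this, hi]⟩
    rw [h1, h2, hT2]; omega
  · intro z hz
    simp only [coe_filter, mem_univ, true_and, Set.mem_ofPred_eq] at hz
    funext i
    by_cases hi : i ∈ S
    · simp [hi, hz.2 i hi]
    · simp [hi]
  · intro T hT
    simp only [mem_coe, mem_powersetCard] at hT
    ext i
    simp only [mem_filter, mem_compl]
    constructor
    · rintro ⟨hi, h⟩; simpa [hi] using h
    · intro hi
      have := hT.1 hi
      rw [mem_compl] at this
      exact ⟨this, by simp [this, hi]⟩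

/-- The probability that `b + b'` given draws without replacement from `T` treated and `S` control
units show a given pattern with `b` treated and `b'` controls. -/
noncomputable def drawProb (b b' T S : ℕ) : ℝ :=
  ((T - b + (S - b')).choose (T - b) : ℝ) / ((T + S).choose T : ℝ)

theorem drawProb_symm (b b' T S : ℕ) : drawProb b b' T S = drawProb b' b S T := by
  have h : ∀ x y : ℕ, (x + y).choose x = (y + x).choose y := fun x y => by
    rw [Nat.choose_symm_add, Nat.add_comm]
  unfold drawProb
  rw [h (T - b), h T]

theorem drawProb_nonneg (b b' T S : ℕ) : 0 ≤ drawProb b b' T S := by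
  unfold drawProb; positivity

/-- The ratio of the two probabilities is (T+1-b)(T+S+1) / ((T+S+1-b-b')(T+1)). Its numerator and
denominator differ by at most (b+b')(T+S+1); the size conditions give T+S+1 ≤ 2(T+S+1-b-b') and L ≤
T+1. -/
theorem abs_drawProb_sub_succ_le {b b' T S : ℕ} {L : ℝ} (hL : 0 < L) (hb : b ≤ T) (hb' : b' ≤ S)
    (hT : L ≤ T + 1) (hB : 2 * ((b : ℝ) + b') ≤ L) :
    |drawProb b b' T S - drawProb b b' (T + 1) S|
      ≤ 2 * ((b : ℝ) + b') / L * drawProb b b' (T + 1) S := by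
  obtain ⟨x, rfl⟩ := Nat.exists_eq_add_of_le hb
  obtain ⟨y, rfl⟩ := Nat.exists_eq_add_of_le hb'
  have e1 : ((x + y + 1 : ℕ) : ℝ) * ((x + y).choose x : ℝ)
      = ((x + 1 + y).choose (x + 1) : ℝ) * ((x + 1 : ℕ) : ℝ) := by
    have := Nat.add_one_mul_choose_eq (x + y) x
    rw [show x + y + 1 = x + 1 + y by ring] at this ⊢
    exact_mod_cast this
  have e2 : ((b + x + (b' + y) + 1 : ℕ) : ℝ) * ((b + x + (b' + y)).choose (b + x) : ℝ)
      = ((b + x + 1 + (b' + y)).choose (b + x + 1) : ℝ) * ((b + x + 1 : ℕ) : ℝ) := by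
    have := Nat.add_one_mul_choose_eq (b + x + (b' + y)) (b + x)
    rw [show b + x + (b' + y) + 1 = b + x + 1 + (b' + y) by ring] at this ⊢
    exact_mod_cast this
  have hP := drawProb_nonneg b b' (b + x + 1) (b' + y)
  have hc1 : (0 : ℝ) < ((b + x + (b' + y)).choose (b + x) : ℝ) := by
    exact_mod_cast Nat.choose_pos (by omega)
  have hc2 : (0 : ℝ) < ((b + x + 1 + (b' + y)).choose (b + x + 1) : ℝ) := by
    exact_mod_cast Nat.choose_pos (by omega)
  set P := drawProb b b' (b + x + 1) (b' + y) with hPdef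
  have key : drawProb b b' (b + x) (b' + y)
      = P * (((x + 1 : ℝ) * (b + x + 1 + (b' + y))) / ((x + y + 1) * (b + x + 1))) := by
    rw [hPdef]
    unfold drawProb
    rw [show b + x - b = x by omega, show b' + y - b' = y by omega,
      show b + x + 1 - b = x + 1 by omega]
    push_cast at e1 e2
    rw [div_mul_div_comm, div_eq_div_iff hc1.ne' (by positivity)]
    have hx : ((x + y).choose x : ℝ)
        = ((x + 1 + y).choose (x + 1) : ℝ) * (x + 1) / (x + y + 1) := by
      rw [eq_div_iff (by positivity)]; linarith
    have hy : ((b + x + 1 + (b' + y)).choose (b + x + 1) : ℝ)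
        = ((b : ℝ) + x + (b' + y) + 1) * ((b + x + (b' + y)).choose (b + x) : ℝ)
          / (b + x + 1) := by
      rw [eq_div_iff (by positivity)]; linarith
    rw [hx, hy]
    field_simp
    ring
  have hr : |((x + 1 : ℝ) * (b + x + 1 + (b' + y))) / ((x + y + 1) * (b + x + 1)) - 1|
      ≤ 2 * ((b : ℝ) + b') / L := by
    have hden : (0 : ℝ) < (x + y + 1) * (b + x + 1) := by positivity
    rw [div_sub_one hden.ne', abs_div, abs_of_pos hden, div_le_div_iff₀ hden hL]
    push_cast at hT
    have hnum : |((x + 1 : ℝ) * (b + x + 1 + (b' + y))) - ((x + y + 1) * (b + x + 1))|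
        ≤ (b + b') * (b + x + 1 + (b' + y)) := by
      rw [abs_le]
      have h0 : (0 : ℝ) ≤ b := by positivity
      have h1 : (0 : ℝ) ≤ b' := by positivity
      have h2 : (0 : ℝ) ≤ x := by positivity
      have h3 : (0 : ℝ) ≤ y := by positivity
      constructor <;> nlinarith [mul_nonneg h0 h1, mul_nonneg h0 h2, mul_nonneg h0 h3,
        mul_nonneg h1 h2, mul_nonneg h1 h3, mul_self_nonneg (b : ℝ), mul_self_nonneg (b' : ℝ)]
    have hy0 : (0 : ℝ) ≤ y := by positivity
    have hx0 : (0 : ℝ) ≤ x := by positivity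
    have hbb : (0 : ℝ) ≤ b + b' := by positivity
    have hhalf : (b + x + 1 + (b' + y) : ℝ) ≤ 2 * (x + y + 1) := by linarith
    calc _ ≤ ((b : ℝ) + b') * (b + x + 1 + (b' + y)) * L := by gcongr
      _ ≤ ((b : ℝ) + b') * (2 * (x + y + 1)) * (b + x + 1) := by gcongr
      _ = _ := by ring
  rw [key, show ∀ r : ℝ, P * r - P = P * (r - 1) by intro r; ring, abs_mul, abs_of_nonneg hP,
    mul_comm]
  gcongr

theorem abs_drawProb_sub_le_iterate {b b' : ℕ} {L : ℝ} (hL : 0 < L)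
    (hB : 2 * ((b : ℝ) + b') ≤ L) (T S a : ℕ) (hT : L ≤ T) (hS : L ≤ S) :
    |drawProb b b' T S - drawProb b b' (T + a) S|
      ≤ ((1 + 2 * ((b : ℝ) + b') / L) ^ a - 1) * drawProb b b' (T + a) S := by
  have hb0 : (0 : ℝ) ≤ b := by positivity
  have hb0' : (0 : ℝ) ≤ b' := by positivity
  have hδ : 0 ≤ 2 * ((b : ℝ) + b') / L := by positivity
  induction a with
  | zero => simp
  | succ a ih =>
    have hbT : b ≤ T + a := by
      have : (b : ℝ) ≤ T := by linarith
      have : b ≤ T := by exact_mod_cast this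
      omega
    have hbS : b' ≤ S := by
      have : (b' : ℝ) ≤ S := by linarith
      exact_mod_cast this
    have hTa : L ≤ ((T + a : ℕ) : ℝ) + 1 := by
      push_cast
      have : (0 : ℝ) ≤ a := by positivity
      linarith
    have h := abs_drawProb_sub_succ_le hL hbT hbS hTa hB
    set δ := 2 * ((b : ℝ) + b') / L
    rw [← Nat.add_assoc]
    have h1 : 1 ≤ (1 + δ) ^ a := one_le_pow₀ (by linarith)
    have hP := drawProb_nonneg b b' (T + a + 1) S
    have h2 : drawProb b b' (T + a) S ≤ (1 + δ) * drawProb b b' (T + a + 1) S := by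
      have := (abs_le.mp h).2; linarith
    calc _ ≤ _ := abs_sub_le _ (drawProb b b' (T + a) S) _
      _ ≤ ((1 + δ) ^ a - 1) * drawProb b b' (T + a) S + δ * drawProb b b' (T + a + 1) S :=
        add_le_add ih h
      _ ≤ ((1 + δ) ^ a - 1) * ((1 + δ) * drawProb b b' (T + a + 1) S)
          + δ * drawProb b b' (T + a + 1) S := by
        gcongr
      _ = _ := by ring

/-- Treated units are returned to the urn before control units, the latter by `drawProb_symm`.
Relative errors compound, hence the power. -/
theorem abs_drawProb_sub_le {b b' : ℕ} {L : ℝ} (hL : 0 < L)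
    (hB : 2 * ((b : ℝ) + b') ≤ L) (T S a a' : ℕ) (hT : L ≤ T) (hS : L ≤ S) :
    |drawProb b b' T S - drawProb b b' (T + a) (S + a')|
      ≤ ((1 + 2 * ((b : ℝ) + b') / L) ^ (a + a') - 1) * drawProb b b' (T + a) (S + a') := by
  have h1 := abs_drawProb_sub_le_iterate hL hB T S a hT hS
  have h2 := abs_drawProb_sub_le_iterate (b := b') (b' := b) hL (by linarith) S (T + a) a' hS
    (by push_cast; have : (0 : ℝ) ≤ a := by positivity
        linarith)
  rw [drawProb_symm b' b, drawProb_symm b' b, add_comm (b' : ℝ)] at h2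
  have hδ : 0 ≤ 2 * ((b : ℝ) + b') / L := by positivity
  set δ := 2 * ((b : ℝ) + b') / L
  have h3 : 1 ≤ (1 + δ) ^ a := one_le_pow₀ (by linarith)
  have hP := drawProb_nonneg b b' (T + a) (S + a')
  have h4 : drawProb b b' (T + a) S ≤ (1 + δ) ^ a' * drawProb b b' (T + a) (S + a') := by
    have := (abs_le.mp h2).2; linarith
  calc _ ≤ _ := abs_sub_le _ (drawProb b b' (T + a) S) _
    _ ≤ _ := add_le_add h1 h2
    _ ≤ ((1 + δ) ^ a - 1) * ((1 + δ) ^ a' * drawProb b b' (T + a) (S + a'))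
        + ((1 + δ) ^ a' - 1) * drawProb b b' (T + a) (S + a') := by
      gcongr
    _ = _ := by rw [pow_add]; ring

theorem one_add_pow_sub_one_le {δ : ℝ} (hδ : 0 ≤ δ) (a : ℕ) (h : a * δ ≤ 1) :
    (1 + δ) ^ a - 1 ≤ 2 * (a * δ) := by
  have h1 : (1 + δ) ^ a ≤ Real.exp (a * δ) := by
    rw [Real.exp_nat_mul]
    gcongr
    linarith [Real.add_one_le_exp δ]
  have h2 := Real.abs_exp_sub_one_le (x := a * δ) (by rw [abs_of_nonneg (by positivity)]; exact h)
  rw [abs_of_nonneg (show 0 ≤ (a : ℝ) * δ by positivity)] at h2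
  linarith [(abs_le.mp h2).2]

end Interference

/-! ### Expectation under complete randomization and near independence -/

namespace Interference

/-- The expectation of `F` under complete randomization with `m` treated units. -/
noncomputable def crExpect {n : ℕ} (m : ℕ) (F : Assignment n → ℝ) : ℝ :=
  (∑ z : Assignment n with ∑ i, (z i).toNat = m, F z) / (n.choose m : ℝ)

section Expect

variable {n m : ℕ}

theorem crExpect_add (F G : Assignment n → ℝ) :
    crExpect m (fun z => F z + G z) = crExpect m F + crExpect m G := by
  simp only [crExpect, Finset.sum_add_distrib, add_div]

theorem crExpect_sub (F G : Assignment n → ℝ) :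
    crExpect m (fun z => F z - G z) = crExpect m F - crExpect m G := by
  simp only [crExpect, Finset.sum_sub_distrib, sub_div]

theorem crExpect_const_mul (c : ℝ) (F : Assignment n → ℝ) :
    crExpect m (fun z => c * F z) = c * crExpect m F := by
  simp only [crExpect, ← Finset.mul_sum, mul_div_assoc]

theorem crExpect_sum {ι : Type*} (s : Finset ι) (F : ι → Assignment n → ℝ) :
    crExpect m (fun z => ∑ i ∈ s, F i z) = ∑ i ∈ s, crExpect m (F i) := by
  simp only [crExpect]
  rw [Finset.sum_comm, Finset.sum_div]

theorem crExpect_mono {F G : Assignment n → ℝ} (h : ∀ z, F z ≤ G z) :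
    crExpect m F ≤ crExpect m G := by
  unfold crExpect
  gcongr
  exact h _

theorem crExpect_nonneg {F : Assignment n → ℝ} (h : ∀ z, 0 ≤ F z) : 0 ≤ crExpect m F :=
  div_nonneg (Finset.sum_nonneg fun z _ => h z) (by positivity)

theorem abs_crExpect_le (F : Assignment n → ℝ) :
    |crExpect m F| ≤ crExpect m (fun z => |F z|) := by
  unfold crExpect
  rw [abs_div, abs_of_nonneg (show (0 : ℝ) ≤ (n.choose m : ℝ) by positivity)]
  gcongr
  exact Finset.abs_sum_le_sum_abs _ _

open Classical in
/-- The probability that the assignment agrees with `w` on `S`. -/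
noncomputable def patProb (m : ℕ) (S : Finset (Fin n)) (w : Assignment n) : ℝ :=
  crExpect m (fun z => if ∀ i ∈ S, z i = w i then 1 else 0)

open Finset in
theorem patProb_eq {l : ℕ} (hn : m + l = n) (S : Finset (Fin n)) (w : Assignment n)
    (ht : #{i ∈ S | w i = true} ≤ m) (hf : #{i ∈ S | w i = false} ≤ l) :
    patProb m S w = drawProb #{i ∈ S | w i = true} #{i ∈ S | w i = false} m l := by
  unfold patProb drawProb crExpect
  rw [← card_filter_eqOn hn S w ht hf, hn]
  congr 1
  rw [← Finset.sum_filter, Finset.filter_filter]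
  simp

theorem crExpect_const (hm : m ≤ n) (c : ℝ) : crExpect (n := n) m (fun _ => c) = c := by
  have h := patProb_eq (n := n) (m := m) (l := n - m) (by omega) ∅ (fun _ => true) (by simp)
    (by simp)
  have hc : ((m + (n - m)).choose m : ℝ) ≠ 0 := by
    exact_mod_cast (Nat.choose_pos (by omega)).ne'
  simp only [patProb, drawProb, Finset.filter_empty, Finset.card_empty, Nat.sub_zero,
    Finset.notMem_empty, false_imp_iff, implies_true, if_true, div_self hc] at h
  have := crExpect_const_mul (m := m) c (fun _ : Assignment n => 1)
  rw [h] at this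
  simpa using this

/-- The chain rule for sequential draws: the second factor is the conditional probability in the
depleted urn. -/
theorem drawProb_add (a a' b b' l : ℕ) :
    drawProb (a + b) (a' + b') m l = drawProb a a' m l * drawProb b b' (m - a) (l - a') := by
  unfold drawProb
  rw [Nat.sub_sub, Nat.sub_sub]
  have : ((m - a + (l - a')).choose (m - a) : ℝ) ≠ 0 := by
    exact_mod_cast (Nat.choose_pos (by omega)).ne'
  field_simp

open Finset in
theorem abs_patProb_union_sub_le {l : ℕ} {c : ℝ} (hc : 0 < c) (hn0 : 0 < n) (hn : m + l = n)
    (hm : c * n ≤ m) (hl : c * n ≤ l) {A B : Finset (Fin n)} (hAB : Disjoint A B) {α β : ℕ}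
    (hA : #A ≤ α) (hB : #B ≤ β) (hα : 1 ≤ α) (hβ : 1 ≤ β) (hs : 8 * (α * β : ℝ) ≤ c * n)
    (u v : Assignment n) :
    |patProb m (A ∪ B) (A.piecewise u v) - patProb m A u * patProb m B v|
      ≤ 8 * (α * β) / (c * n) * (patProb m A u * patProb m B v) := by
  have hcn : 0 < c * n := by positivity
  have hα' : (1 : ℝ) ≤ α := by exact_mod_cast hα
  have hβ' : (1 : ℝ) ≤ β := by exact_mod_cast hβ
  have hα8 : 8 * (α : ℝ) ≤ c * n := by nlinarith
  have hβ8 : 8 * (β : ℝ) ≤ c * n := by nlinarith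
  have hsplit : ∀ (S : Finset (Fin n)) (w : Assignment n),
      #{i ∈ S | w i = true} + #{i ∈ S | w i = false} = #S := by
    intro S w
    rw [← Finset.card_filter_add_card_filter_not (s := S) (fun i => w i = true)]
    simp
  have hpiece : ∀ t : Bool, #{i ∈ A ∪ B | A.piecewise u v i = t}
      = #{i ∈ A | u i = t} + #{i ∈ B | v i = t} := by
    intro t
    rw [filter_union, card_union_of_disjoint (disjoint_filter_filter hAB)]
    congr 2
    · exact filter_congr fun i hi => by simp [Finset.piecewise, hi]
    · exact filter_congr fun i hi => by
        simp [Finset.piecewise, Finset.disjoint_right.mp hAB hi]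
  have hsA := hsplit A u
  have hsB := hsplit B v
  have ht := hpiece true
  have hf := hpiece false
  set a := #{i ∈ A | u i = true}
  set a' := #{i ∈ A | u i = false}
  set b := #{i ∈ B | v i = true}
  set b' := #{i ∈ B | v i = false}
  have haα : (a : ℝ) + a' ≤ α := by exact_mod_cast (hsA ▸ hA)
  have hbβ : (b : ℝ) + b' ≤ β := by exact_mod_cast (hsB ▸ hB)
  have ha0 : (0 : ℝ) ≤ a := by positivity
  have ha0' : (0 : ℝ) ≤ a' := by positivity
  have hb0 : (0 : ℝ) ≤ b := by positivity
  have hb0' : (0 : ℝ) ≤ b' := by positivity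
  have h1 : a + b ≤ m := by
    have : (a : ℝ) + b ≤ m := by linarith
    exact_mod_cast this
  have h2 : a' + b' ≤ l := by
    have : (a' : ℝ) + b' ≤ l := by linarith
    exact_mod_cast this
  rw [patProb_eq hn (A ∪ B) _ (by rw [ht]; exact h1) (by rw [hf]; exact h2), ht, hf,
    patProb_eq hn A u (by omega) (by omega), patProb_eq hn B v (by omega) (by omega),
    drawProb_add, ← mul_sub, abs_mul,
    abs_of_nonneg (drawProb_nonneg _ _ _ _), mul_left_comm]
  refine mul_le_mul_of_nonneg_left ?_ (drawProb_nonneg _ _ _ _)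
  -- At most `α` ≤ cn/8 units are removed, so each arm of the depleted urn keeps at least cn/2.
  have h := abs_drawProb_sub_le (b := b) (b' := b') (L := c * n / 2) (by positivity)
    (by linarith) (m - a) (l - a') a a'
    (by rw [Nat.cast_sub (by omega)]; linarith) (by rw [Nat.cast_sub (by omega)]; linarith)
  rw [show m - a + a = m by omega, show l - a' + a' = l by omega] at h
  refine h.trans (mul_le_mul_of_nonneg_right ?_ (drawProb_nonneg _ _ _ _))
  -- The exponent times the relative step is at most 4αβ/(cn) ≤ 1; linearizing the power costs the
  -- factor 2 that gives the constant 8.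
  have hle : ((a + a' : ℕ) : ℝ) * (2 * ((b : ℝ) + b') / (c * n / 2))
      ≤ 4 * (α * β) / (c * n) := by
    rw [div_div_eq_mul_div, mul_div_assoc', div_le_div_iff_of_pos_right hcn]
    push_cast
    have : ((a : ℝ) + a') * (b + b') ≤ α * β := by gcongr
    linarith
  have hle1 : 4 * (α * β : ℝ) / (c * n) ≤ 1 := by
    rw [div_le_one hcn]; nlinarith
  refine (one_add_pow_sub_one_le (by positivity) _ (hle.trans hle1)).trans ?_
  calc _ ≤ 2 * (4 * (α * β : ℝ) / (c * n)) := by gcongr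
    _ = _ := by ring

open Classical in
/-- The number of assignments that agree with `u` on `S`. -/
noncomputable def agreeCard (S : Finset (Fin n)) (u : Assignment n) : ℝ :=
  (Finset.card {z : Assignment n | ∀ i ∈ S, z i = u i} : ℝ)

theorem agreeCard_nonneg (S : Finset (Fin n)) (u : Assignment n) : 0 ≤ agreeCard S u := by
  unfold agreeCard; positivity

open Classical in
-- Patterns on `S` are indexed by full assignments, so each is counted `agreeCard` times and the
-- weight corrects for this.
theorem sum_agree_div_agreeCard {S : Finset (Fin n)} {h : Assignment n → ℝ} (hh : DependsOn h S)
    (z : Assignment n) :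
    ∑ u : Assignment n, (if ∀ i ∈ S, z i = u i then h u / agreeCard S u else 0) = h z := by
  have hpos : (0 : ℝ) < agreeCard S z := by
    unfold agreeCard
    exact_mod_cast Finset.card_pos.mpr ⟨z, by simp⟩
  have hset : Finset.card {u : Assignment n | ∀ i ∈ S, z i = u i}
      = Finset.card {x : Assignment n | ∀ i ∈ S, x i = z i} := by
    congr 1; ext x; simp [eq_comm]
  rw [← Finset.sum_filter, Finset.sum_congr rfl (g := fun _ => h z / agreeCard S z)]
  · rw [Finset.sum_const, nsmul_eq_mul, hset]
    change agreeCard S z * _ = _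
    field_simp
  · intro u hu
    simp only [Finset.mem_filter, Finset.mem_univ, true_and] at hu
    rw [hh (fun i hi => (hu i (by exact_mod_cast hi)).symm : ∀ i ∈ (S : Set (Fin n)), u i = z i)]
    congr 1
    unfold agreeCard
    congr 2
    ext x
    simp only [Finset.mem_filter, Finset.mem_univ, true_and]
    exact forall₂_congr fun i hi => by rw [hu i hi]

theorem crExpect_eq_sum {A : Finset (Fin n)} {f : Assignment n → ℝ} (hf : DependsOn f A) :
    crExpect m f = ∑ u : Assignment n, f u / agreeCard A u * patProb m A u := by
  classical
  unfold patProb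
  simp_rw [← crExpect_const_mul, ← crExpect_sum]
  congr 1
  funext z
  rw [← sum_agree_div_agreeCard hf z]
  refine Finset.sum_congr rfl fun u _ => ?_
  split_ifs <;> simp_all

theorem crExpect_mul_eq_sum {A B : Finset (Fin n)} (hAB : Disjoint A B)
    {f g : Assignment n → ℝ} (hf : DependsOn f A) (hg : DependsOn g B) :
    crExpect m (fun z => f z * g z)
      = ∑ u : Assignment n, ∑ v : Assignment n, f u / agreeCard A u * (g v / agreeCard B v)
          * patProb m (A ∪ B) (A.piecewise u v) := by
  classical
  have hiff : ∀ u v z : Assignment n, (∀ i ∈ A ∪ B, z i = A.piecewise u v i) ↔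
      (∀ i ∈ A, z i = u i) ∧ ∀ i ∈ B, z i = v i := by
    intro u v z
    constructor
    · intro h
      exact ⟨fun i hi => by simpa [hi] using h i (Finset.mem_union_left _ hi),
        fun i hi => by
          simpa [Finset.disjoint_right.mp hAB hi] using h i (Finset.mem_union_right _ hi)⟩
    · rintro ⟨h1, h2⟩ i hi
      by_cases hiA : i ∈ A
      · simp [hiA, h1 i hiA]
      · have := (Finset.mem_union.mp hi).resolve_left hiA
        simp [hiA, h2 i this]
  unfold patProb
  simp_rw [← crExpect_const_mul, ← crExpect_sum]
  congr 1
  funext z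
  rw [← sum_agree_div_agreeCard hf z, ← sum_agree_div_agreeCard hg z, Finset.sum_mul_sum]
  refine Finset.sum_congr rfl fun u _ => Finset.sum_congr rfl fun v _ => ?_
  by_cases h1 : ∀ i ∈ A, z i = u i
  · by_cases h2 : ∀ i ∈ B, z i = v i
    · rw [if_pos h1, if_pos h2, if_pos ((hiff u v z).mpr ⟨h1, h2⟩), mul_one]
    · rw [if_neg h2, if_neg fun h => h2 ((hiff u v z).mp h).2, mul_zero, mul_zero]
  · rw [if_neg h1, if_neg fun h => h1 ((hiff u v z).mp h).1, zero_mul, mul_zero]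

theorem dependsOn_abs {S : Set (Fin n)} {f : Assignment n → ℝ} (hf : DependsOn f S) :
    DependsOn (fun z => |f z|) S := fun x y h => by
  change |f x| = |f y|
  rw [hf h]

/-- Functions of disjoint sets of treatments are nearly uncorrelated under complete
randomization. -/
theorem abs_crExpect_mul_sub_le {l : ℕ} {c : ℝ} (hc : 0 < c) (hn0 : 0 < n) (hn : m + l = n)
    (hm : c * n ≤ m) (hl : c * n ≤ l) {A B : Finset (Fin n)} (hAB : Disjoint A B) {α β : ℕ}
    (hA : A.card ≤ α) (hB : B.card ≤ β) (hα : 1 ≤ α) (hβ : 1 ≤ β)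
    {f g : Assignment n → ℝ} (hf : DependsOn f A) (hg : DependsOn g B) :
    |crExpect m (fun z => f z * g z) - crExpect m f * crExpect m g|
      ≤ 8 * (α * β) / (c * n) * (crExpect m (fun z => |f z * g z|)
        + crExpect m (fun z => |f z|) * crExpect m (fun z => |g z|)) := by
  have hcn : 0 < c * n := by positivity
  have hfg : 0 ≤ crExpect m (fun z => |f z * g z|) := crExpect_nonneg fun z => abs_nonneg _
  have hfa : 0 ≤ crExpect m (fun z => |f z|) := crExpect_nonneg fun z => abs_nonneg _
  have hga : 0 ≤ crExpect m (fun z => |g z|) := crExpect_nonneg fun z => abs_nonneg _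
  by_cases hs : 8 * (α * β : ℝ) ≤ c * n
  · have hε : 0 ≤ 8 * (α * β : ℝ) / (c * n) := by positivity
    refine le_trans ?_ (mul_le_mul_of_nonneg_left (le_add_of_nonneg_left hfg) hε)
    rw [crExpect_mul_eq_sum hAB hf hg, crExpect_eq_sum hf, crExpect_eq_sum hg,
      crExpect_eq_sum (dependsOn_abs hf), crExpect_eq_sum (dependsOn_abs hg),
      Finset.sum_mul_sum, Finset.sum_mul_sum, ← Finset.sum_sub_distrib, Finset.mul_sum]
    refine (Finset.abs_sum_le_sum_abs _ _).trans (Finset.sum_le_sum fun u _ => ?_)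
    rw [← Finset.sum_sub_distrib, Finset.mul_sum]
    refine (Finset.abs_sum_le_sum_abs _ _).trans (Finset.sum_le_sum fun v _ => ?_)
    have h := abs_patProb_union_sub_le hc hn0 hn hm hl hAB hA hB hα hβ hs u v
    have e : ∀ a b p p' r : ℝ, a * b * r - a * p * (b * p') = a * b * (r - p * p') := by
      intros; ring
    rw [e, abs_mul, abs_mul, abs_div, abs_div, abs_of_nonneg (agreeCard_nonneg A u),
      abs_of_nonneg (agreeCard_nonneg B v)]
    have hnn : 0 ≤ |f u| / agreeCard A u * (|g v| / agreeCard B v) :=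
      mul_nonneg (div_nonneg (abs_nonneg _) (agreeCard_nonneg _ _))
        (div_nonneg (abs_nonneg _) (agreeCard_nonneg _ _))
    calc _ ≤ _ := mul_le_mul_of_nonneg_left h hnn
      _ = _ := by ring
  -- For large sets the prefactor exceeds 1 and the triangle inequality suffices; this case is why
  -- the bound contains E|fg|.
  · have h1 : 1 ≤ 8 * (α * β : ℝ) / (c * n) := by
      rw [one_le_div hcn]; linarith
    calc _ ≤ |crExpect m (fun z => f z * g z)| + |crExpect m f * crExpect m g| := abs_sub _ _
      _ ≤ crExpect m (fun z => |f z * g z|)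
          + crExpect m (fun z => |f z|) * crExpect m (fun z => |g z|) := by
        rw [abs_mul]
        gcongr <;> exact abs_crExpect_le _
      _ ≤ _ := le_mul_of_one_le_left (by positivity) h1

end Expect

end Interference

/-! ### Unit errors and the mean squared error -/

namespace Interference

section Sample

variable {n m l : ℕ}

open Classical in
/-- The units that interfere with unit `i`. -/
noncomputable def interferers (y : Outcomes n) (i : Fin n) : Finset (Fin n) :=
  {j | Interferes y j i}

theorem mem_interferers {y : Outcomes n} {i j : Fin n} :
    j ∈ interferers y i ↔ Interferes y j i := by
  simp [interferers]

theorem self_mem_interferers (y : Outcomes n) (i : Fin n) : i ∈ interferers y i :=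
  mem_interferers.mpr (Or.inr rfl)

theorem one_le_card_interferers (y : Outcomes n) (i : Fin n) : 1 ≤ (interferers y i).card :=
  Finset.card_pos.mpr ⟨i, self_mem_interferers y i⟩

theorem disjoint_interferers {y : Outcomes n} {i j : Fin n}
    (h : ¬ InterferenceDependent y i j) : Disjoint (interferers y i) (interferers y j) := by
  rw [Finset.disjoint_left]
  intro l h1 h2
  exact h ⟨l, mem_interferers.mp h1, mem_interferers.mp h2⟩

/-- An outcome depends only on the treatments of the units that interfere with it. -/
theorem dependsOn_outcome (y : Outcomes n) (i : Fin n) :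
    DependsOn (y i) (interferers y i : Set (Fin n)) := by
  intro x x' hxx'
  -- Coordinates outside the interferers are switched one at a time; a change of the outcome would
  -- make the switched unit an interferer.
  have key : ∀ T : Finset (Fin n), Disjoint T (interferers y i) →
      y i (T.piecewise x' x) = y i x := by
    intro T
    induction T using Finset.induction_on with
    | empty => intro _; simp
    | insert j T hj ih =>
      intro hT
      rw [Finset.disjoint_insert_left] at hT
      rw [← ih hT.2, Finset.piecewise_insert]
      by_contra hne
      refine hT.1 (mem_interferers.mpr (Or.inl ⟨_, _, fun l hl => ?_, hne⟩))
      simp [hl]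
  have h := key (interferers y i)ᶜ disjoint_compl_left
  rw [← h]
  congr 1
  funext j
  by_cases hj : j ∈ interferers y i
  · simp [hj, hxx' j (by exact_mod_cast hj)]
  · simp [hj]

/-- Fixing the treatment of `i` removes `i` from the dependence set, making it disjoint from `{i}`
as the bias bound requires. -/
theorem dependsOn_outcome_update (y : Outcomes n) (i : Fin n) (b : Bool) :
    DependsOn (fun z => y i (Function.update z i b))
      (((interferers y i).erase i : Finset (Fin n)) : Set (Fin n)) := by
  intro x x' h
  refine dependsOn_outcome y i fun j hj => ?_
  by_cases hji : j = i
  · subst hji; simp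
  · simp [hji, h j (by simpa [hji] using hj)]

/-- The marginal probability of treatment arm `b`. -/
noncomputable def armProb (n m l : ℕ) (b : Bool) : ℝ := if b then (m : ℝ) / n else (l : ℝ) / n

theorem drawProb_one_zero (hm : 0 < m) : drawProb 1 0 m l = (m : ℝ) / ((m + l : ℕ) : ℝ) := by
  obtain ⟨k, rfl⟩ := Nat.exists_eq_add_of_le' hm
  have h := Nat.add_one_mul_choose_eq (k + l) k
  rw [show k + l + 1 = k + 1 + l by ring] at h
  have hc : ((k + 1 + l).choose (k + 1) : ℝ) ≠ 0 := by
    exact_mod_cast (Nat.choose_pos (by omega)).ne'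
  have hc' : ((k + 1 + l : ℕ) : ℝ) ≠ 0 := by
    exact_mod_cast (by omega : k + 1 + l ≠ 0)
  unfold drawProb
  rw [div_eq_div_iff hc hc']
  simp only [Nat.add_sub_cancel, Nat.sub_zero]
  rw [mul_comm, mul_comm ((k + 1 : ℕ) : ℝ)]
  exact_mod_cast h

/-- Each unit is in arm `b` with probability `armProb n m l b`. -/
theorem crExpect_arm (hn : m + l = n) (hm : 0 < m) (hl : 0 < l) (i : Fin n) (b : Bool) :
    crExpect m (fun z : Assignment n => if z i = b then 1 else 0) = armProb n m l b := by
  have h : crExpect m (fun z : Assignment n => if z i = b then 1 else 0)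
      = patProb m {i} (fun _ => b) := by
    unfold patProb
    congr 1
    funext z
    simp
  rw [h]
  cases b with
  | true =>
    rw [patProb_eq hn {i} _ (by simp; omega) (by simp)]
    simp [drawProb_one_zero hm, armProb, ← hn]
  | false =>
    rw [patProb_eq hn {i} _ (by simp) (by simp; omega)]
    simp [drawProb_symm 0 1, drawProb_one_zero hl, armProb, ← hn, add_comm]

theorem mul_outcome_eq (y : Outcomes n) (i : Fin n) (b : Bool) (z : Assignment n) :
    (if z i = b then 1 else 0) * y i z
      = (if z i = b then 1 else 0) * y i (Function.update z i b) := by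
  split_ifs with h
  · rw [← h, Function.update_eq_self]
  · simp

/-- The bias of the inverse probability weighted mean of arm `b` for unit `i`. -/
theorem abs_arm_bias_le {c κ : ℝ} (hc : 0 < c) (hn0 : 0 < n) (hn : m + l = n)
    (hm : c * n ≤ m) (hl : c * n ≤ l) (y : Outcomes n) (i : Fin n) (b : Bool)
    (hκ : crExpect m (fun z => |y i (Function.update z i b)|) ≤ κ) :
    |crExpect m (fun z => (if z i = b then 1 else 0) * y i z / armProb n m l b)
        - crExpect m (fun z => y i (Function.update z i b))|
      ≤ 16 * κ / c ^ 2 * ((interferers y i).card / n) := by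
  have hn0' : (0 : ℝ) < n := by exact_mod_cast hn0
  have hcn : 0 < c * n := by positivity
  have hm0 : 0 < m := by
    have : (0 : ℝ) < m := by linarith
    exact_mod_cast this
  have hl0 : 0 < l := by
    have : (0 : ℝ) < l := by linarith
    exact_mod_cast this
  have hpc : c ≤ armProb n m l b := by
    unfold armProb
    split_ifs <;> rwa [le_div_iff₀ hn0']
  have hp1 : armProb n m l b ≤ 1 := by
    have : (m : ℝ) + l = n := by exact_mod_cast hn
    unfold armProb
    split_ifs <;> rw [div_le_one hn0'] <;> linarith
  have hp0 : 0 < armProb n m l b := by linarith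
  have hE := crExpect_arm hn hm0 hl0 i b
  -- The size bound keeps `i` in the count, since the erased set may be empty and `β` must be at
  -- least 1.
  have h := abs_crExpect_mul_sub_le hc hn0 hn hm hl (A := {i}) (B := (interferers y i).erase i)
    (by simp) (α := 1) (β := (interferers y i).card) (by simp)
    (Finset.card_le_card (Finset.erase_subset _ _)) le_rfl (one_le_card_interferers y i)
    (f := fun z => if z i = b then 1 else 0)
    (fun x x' hx => by simp [hx i (by simp)]) (dependsOn_outcome_update y i b)
  have ha : ∀ z : Assignment n, |(if z i = b then 1 else 0 : ℝ)| = if z i = b then 1 else 0 :=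
    fun z => by split_ifs <;> simp
  simp only [ha, hE] at h
  simp_rw [← mul_outcome_eq] at h
  have hκ0 : 0 ≤ crExpect m (fun z => |y i (Function.update z i b)|) :=
    crExpect_nonneg fun z => abs_nonneg _
  have h2 : crExpect m (fun z : Assignment n => |(if z i = b then 1 else 0) * y i z|) ≤ κ := by
    refine (crExpect_mono fun z => ?_).trans hκ
    rw [mul_outcome_eq, abs_mul, ha]
    refine mul_le_of_le_one_left (abs_nonneg _) ?_
    split_ifs <;> norm_num
  have h3 : armProb n m l b * crExpect m (fun z => |y i (Function.update z i b)|) ≤ κ :=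
    (mul_le_of_le_one_left hκ0 hp1).trans hκ
  have hdiv : crExpect m (fun z : Assignment n => (if z i = b then 1 else 0) * y i z
        / armProb n m l b)
      = crExpect m (fun z : Assignment n => (if z i = b then 1 else 0) * y i z)
        / armProb n m l b := by
    rw [div_eq_inv_mul, ← crExpect_const_mul]
    simp only [div_eq_inv_mul]
  rw [hdiv, div_sub' hp0.ne', abs_div, abs_of_pos hp0, div_le_iff₀ hp0]
  refine h.trans ?_
  have hN0 : (0 : ℝ) ≤ (interferers y i).card := by positivity
  have hκ' : 0 ≤ κ := hκ0.trans hκ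
  -- One factor 1/c comes from near independence, the other from dividing by an arm probability of
  -- at least `c`.
  calc _ ≤ 8 * (((1 : ℕ) : ℝ) * (interferers y i).card) / (c * n) * (κ + κ) := by gcongr
    _ = 16 * κ / c ^ 2 * ((interferers y i).card / n) * c := by
      push_cast; field_simp; ring
    _ ≤ _ := by gcongr

/-- The deviation of the contribution of unit `i` to the Horvitz-Thompson estimator from its
expected treatment effect. -/
noncomputable def unitError (m l : ℕ) (y : Outcomes n) (i : Fin n) (z : Assignment n) : ℝ :=
  (if z i = true then 1 else 0) * y i z / armProb n m l true
    - (if z i = false then 1 else 0) * y i z / armProb n m l false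
    - (crExpect m (fun z => y i (Function.update z i true))
      - crExpect m (fun z => y i (Function.update z i false)))

theorem dependsOn_unitError (y : Outcomes n) (i : Fin n) :
    DependsOn (unitError m l y i) (interferers y i : Set (Fin n)) := by
  intro x x' h
  unfold unitError
  rw [dependsOn_outcome y i h, h i (by exact_mod_cast self_mem_interferers y i)]

theorem abs_crExpect_unitError_le {c κ : ℝ} (hc : 0 < c) (hn0 : 0 < n) (hn : m + l = n)
    (hm : c * n ≤ m) (hl : c * n ≤ l) (y : Outcomes n) (i : Fin n)
    (hκ : ∀ b, crExpect m (fun z => |y i (Function.update z i b)|) ≤ κ) :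
    |crExpect m (unitError m l y i)| ≤ 32 * κ / c ^ 2 * ((interferers y i).card / n) := by
  have h1 := abs_arm_bias_le hc hn0 hn hm hl y i true (hκ true)
  have h0 := abs_arm_bias_le hc hn0 hn hm hl y i false (hκ false)
  unfold unitError
  rw [crExpect_sub, crExpect_sub, crExpect_const (by omega)]
  rw [show ∀ a b p q : ℝ, a - b - (p - q) = (a - p) - (b - q) by intros; ring]
  refine (abs_sub _ _).trans ((add_le_add h1 h0).trans (le_of_eq ?_))
  ring

theorem crExpect_unitError_sq_le {c V κ : ℝ} (hc : 0 < c) (hn0 : 0 < n) (hn : m + l = n)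
    (hm : c * n ≤ m) (hl : c * n ≤ l) (y : Outcomes n) (i : Fin n)
    (hV : crExpect m (fun z => y i z ^ 2) ≤ V)
    (hκ : ∀ b, crExpect m (fun z => |y i (Function.update z i b)|) ≤ κ) :
    crExpect m (fun z => unitError m l y i z ^ 2) ≤ 2 * V / c ^ 2 + 8 * κ ^ 2 := by
  have hn0' : (0 : ℝ) < n := by exact_mod_cast hn0
  have hpc : ∀ b, c ≤ armProb n m l b := by
    intro b
    unfold armProb
    split_ifs <;> rwa [le_div_iff₀ hn0']
  have hτ : ∀ b, |crExpect m (fun z => y i (Function.update z i b))| ≤ κ := fun b =>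
    (abs_crExpect_le _).trans (hκ b)
  set τ := crExpect m (fun z => y i (Function.update z i true))
      - crExpect m (fun z => y i (Function.update z i false)) with hτdef
  have hκ0 : 0 ≤ κ := (abs_nonneg _).trans (hτ true)
  have hτ2 : τ ^ 2 ≤ (2 * κ) ^ 2 := by
    rw [sq_le_sq, abs_of_nonneg (show 0 ≤ 2 * κ by positivity)]
    refine (abs_sub _ _).trans ?_
    linarith [hτ true, hτ false]
  have hsq : ∀ b, ∀ x : ℝ, (x / armProb n m l b) ^ 2 ≤ x ^ 2 / c ^ 2 := by
    intro b x
    rw [div_pow]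
    gcongr
    exact hpc b
  -- Exactly one arm is active, so the error is a single weighted outcome w minus `τ`, and (w-τ)² ≤
  -- 2w² + 2τ² with |τ| ≤ 2κ.
  have hpt : ∀ z, unitError m l y i z ^ 2 ≤ 2 / c ^ 2 * y i z ^ 2 + 8 * κ ^ 2 := by
    intro z
    have hw : ∀ w : ℝ, w ^ 2 ≤ y i z ^ 2 / c ^ 2 → (w - τ) ^ 2
        ≤ 2 / c ^ 2 * y i z ^ 2 + 8 * κ ^ 2 := by
      intro w hw
      have : (w - τ) ^ 2 ≤ 2 * w ^ 2 + 2 * τ ^ 2 := by nlinarith [sq_nonneg (w + τ)]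
      calc _ ≤ 2 * w ^ 2 + 2 * τ ^ 2 := this
        _ ≤ 2 * (y i z ^ 2 / c ^ 2) + 2 * (2 * κ) ^ 2 := by gcongr
        _ = _ := by ring
    apply hw
    cases hz : z i with
    | true => simpa using hsq true (y i z)
    | false => simpa using hsq false (y i z)
  refine (crExpect_mono hpt).trans ?_
  rw [crExpect_add, crExpect_const_mul, crExpect_const (by omega)]
  have : 2 / c ^ 2 * crExpect m (fun z => y i z ^ 2) ≤ 2 / c ^ 2 * V := by gcongr
  linarith [show 2 / c ^ 2 * V = 2 * V / c ^ 2 by ring]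

theorem crExpect_abs_mul_le {Q : ℝ} {f g : Assignment n → ℝ}
    (hf : crExpect m (fun z => f z ^ 2) ≤ Q) (hg : crExpect m (fun z => g z ^ 2) ≤ Q) :
    crExpect m (fun z => |f z * g z|) ≤ Q := by
  have h : crExpect m (fun z => |f z * g z|)
      ≤ crExpect m (fun z => 1 / 2 * (f z ^ 2 + g z ^ 2)) := by
    refine crExpect_mono fun z => ?_
    rw [abs_le]
    constructor <;> nlinarith [sq_nonneg (f z + g z), sq_nonneg (f z - g z)]
  rw [crExpect_const_mul, crExpect_add] at h
  linarith

theorem crExpect_abs_le {Q : ℝ} (hm : m ≤ n) {f : Assignment n → ℝ}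
    (hf : crExpect m (fun z => f z ^ 2) ≤ Q) : crExpect m (fun z => |f z|) ≤ 1 + Q := by
  have h : crExpect m (fun z => |f z|) ≤ crExpect m (fun z => 1 + f z ^ 2) := by
    refine crExpect_mono fun z => ?_
    rw [abs_le]
    constructor <;> nlinarith [sq_nonneg (f z + 1), sq_nonneg (f z - 1)]
  rw [crExpect_add, crExpect_const hm] at h
  linarith

open Classical in
/-- The mean squared error of the Horvitz-Thompson estimator under complete randomization. -/
theorem exists_mse_le {c V κ : ℝ} (hc : 0 < c) (hV0 : 0 ≤ V) (hκ0 : 0 ≤ κ) :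
    ∃ K : ℝ, 0 < K ∧ ∀ {n m l : ℕ} (y : Outcomes n), 0 < n → m + l = n → c * n ≤ m → c * n ≤ l →
      (∀ i, crExpect m (fun z => y i z ^ 2) ≤ V) →
      (∀ i b, crExpect m (fun z => |y i (Function.update z i b)|) ≤ κ) →
      crExpect m (fun z => ((1 / (n : ℝ)) * ∑ i, unitError m l y i z) ^ 2)
        ≤ K * (dAvg y / n + cAvg y ^ 2 / n) := by
  set Q := 2 * V / c ^ 2 + 8 * κ ^ 2 with hQ
  have hQ0 : 0 ≤ Q := by positivity
  -- `Q` serves the dependent pairs. For the others, the middle term bounds the covariance and the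
  -- last one the product of the two biases.
  refine ⟨Q + (8 / c * (Q + (1 + Q) * (1 + Q)) + (32 * κ / c ^ 2) ^ 2), by positivity, ?_⟩
  intro n m l y hn0 hn hm hl hV hκ
  set K₂ := 8 / c * (Q + (1 + Q) * (1 + Q)) + (32 * κ / c ^ 2) ^ 2 with hK₂
  have hK₂0 : 0 ≤ K₂ := by positivity
  have hn0' : (0 : ℝ) < n := by exact_mod_cast hn0
  have hn1 : (1 : ℝ) ≤ n := by exact_mod_cast hn0
  have hsq := fun i => crExpect_unitError_sq_le hc hn0 hn hm hl y i (hV i) (hκ i)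
  have hbias := fun i => abs_crExpect_unitError_le hc hn0 hn hm hl y i (hκ i)
  have hpair : ∀ i j, crExpect m (fun z => unitError m l y i z * unitError m l y j z)
      ≤ (Q + K₂) * ((if InterferenceDependent y i j then 1 else 0)
        + ((interferers y i).card : ℝ) * (interferers y j).card / n) := by
    intro i j
    have habs := crExpect_abs_mul_le (hsq i) (hsq j)
    by_cases hd : InterferenceDependent y i j
    · rw [if_pos hd]
      calc _ ≤ Q := (le_abs_self _).trans ((abs_crExpect_le _).trans habs)
        _ ≤ (Q + K₂) * 1 := by linarith
        _ ≤ _ := by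
          gcongr
          exact le_add_of_nonneg_right (by positivity)
    · rw [if_neg hd, zero_add]
      have h := abs_crExpect_mul_sub_le hc hn0 hn hm hl (disjoint_interferers hd) le_rfl le_rfl
        (one_le_card_interferers y i) (one_le_card_interferers y j)
        (dependsOn_unitError (m := m) (l := l) y i) (dependsOn_unitError (m := m) (l := l) y j)
      have hi := crExpect_abs_le (by omega) (hsq i)
      have hj := crExpect_abs_le (by omega) (hsq j)
      set a : ℝ := ((interferers y i).card : ℝ)
      set b : ℝ := ((interferers y j).card : ℝ)
      have ha : 0 ≤ a := by positivity
      have hb : 0 ≤ b := by positivity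
      have hprod : crExpect m (unitError m l y i) * crExpect m (unitError m l y j)
          ≤ (32 * κ / c ^ 2) ^ 2 * (a * b / n) := by
        calc _ ≤ |crExpect m (unitError m l y i)| * |crExpect m (unitError m l y j)| := by
              rw [← abs_mul]; exact le_abs_self _
          _ ≤ (32 * κ / c ^ 2 * (a / n)) * (32 * κ / c ^ 2 * (b / n)) := by
            gcongr
            · exact hbias i
            · exact hbias j
          _ = (32 * κ / c ^ 2) ^ 2 * (a * b / n) / n := by ring
          -- The product of biases is of order ab/n², so a factor 1/n is given away to match the
          -- covariance.
          _ ≤ _ := div_le_self (by positivity) hn1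
      have hcov : 8 * (a * b) / (c * n)
            * (crExpect m (fun z => |unitError m l y i z * unitError m l y j z|)
              + crExpect m (fun z => |unitError m l y i z|)
                * crExpect m (fun z => |unitError m l y j z|))
          ≤ 8 / c * (Q + (1 + Q) * (1 + Q)) * (a * b / n) := by
        have h0 : 0 ≤ crExpect m (fun z => |unitError m l y j z|) :=
          crExpect_nonneg fun z => abs_nonneg _
        calc _ ≤ 8 * (a * b) / (c * n) * (Q + (1 + Q) * (1 + Q)) := by gcongr
          _ = _ := by field_simp
      have := (abs_le.mp h).2
      calc _ ≤ K₂ * (a * b / n) := by rw [hK₂, add_mul]; linarith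
        _ ≤ _ := by gcongr; linarith
  have hexp : crExpect m (fun z => ((1 / (n : ℝ)) * ∑ i, unitError m l y i z) ^ 2)
      = (1 / (n : ℝ)) ^ 2 * ∑ i, ∑ j,
        crExpect m (fun z => unitError m l y i z * unitError m l y j z) := by
    simp_rw [mul_pow, pow_two (∑ i, _), Finset.sum_mul_sum]
    rw [crExpect_const_mul, crExpect_sum]
    simp_rw [crExpect_sum]
  -- Double counting: incoming and outgoing interference have the same total.
  have hcsum : ∑ i, ((interferers y i).card : ℝ) = n * cAvg y := by
    unfold cAvg interferenceCount
    rw [← mul_assoc, mul_one_div_cancel hn0'.ne', one_mul, Finset.sum_comm]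
    refine Finset.sum_congr rfl fun i _ => ?_
    simp [interferers]
  have hdsum : ∑ i : Fin n, ∑ j : Fin n, (if InterferenceDependent y i j then (1 : ℝ) else 0)
      = n * dAvg y := by
    unfold dAvg
    rw [← mul_assoc, mul_one_div_cancel hn0'.ne', one_mul]
  rw [hexp]
  calc _ ≤ (1 / (n : ℝ)) ^ 2 * ∑ i, ∑ j, (Q + K₂)
          * ((if InterferenceDependent y i j then 1 else 0)
            + ((interferers y i).card : ℝ) * (interferers y j).card / n) := by
        gcongr with i _ j _
        exact hpair i j
    _ = (1 / (n : ℝ)) ^ 2 * ((Q + K₂) * (n * dAvg y + (n * cAvg y) * (n * cAvg y) / n)) := by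
        simp_rw [← Finset.mul_sum, Finset.sum_add_distrib, ← Finset.sum_div, ← Finset.sum_mul_sum]
        rw [hcsum, hdsum]
    _ = _ := by field_simp

end Sample

end Interference

/-! ### Transfer to the probability space -/

namespace Interference

section Transfer

variable {n m l : ℕ} {Ω : Type*} [MeasurableSpace Ω] {μ : Measure Ω} [IsProbabilityMeasure μ]
  {Z : Ω → Assignment n}

theorem IsCompleteRandomization.integral_eq (h : IsCompleteRandomization μ Z m)
    (hZ : Measurable Z) (F : Assignment n → ℝ) : ∫ ω, F (Z ω) ∂μ = crExpect m F := by
  have : IsProbabilityMeasure (μ.map Z) := Measure.isProbabilityMeasure_map hZ.aemeasurable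
  rw [← integral_map hZ.aemeasurable (f := F) (measurable_of_finite F).aestronglyMeasurable,
    integral_fintype .of_finite]
  unfold crExpect
  rw [Finset.sum_filter, Finset.sum_div]
  refine Finset.sum_congr rfl fun z _ => ?_
  have hz : (μ.map Z).real {z} = μ.real {ω | Z ω = z} :=
    map_measureReal_apply hZ (measurableSet_singleton z)
  rw [hz, h z]
  split_ifs
  · rw [smul_eq_mul, div_eq_inv_mul]
  · simp

theorem integrable_comp_assignment (hZ : Measurable Z) (F : Assignment n → ℝ) :
    Integrable (fun ω => F (Z ω)) μ :=
  (Integrable.of_finite (μ := μ.map Z) (f := F)).comp_measurable hZ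

theorem IsCompleteRandomization.treatProb_eq (h : IsCompleteRandomization μ Z m)
    (hZ : Measurable Z) (hn : m + l = n) (hm : 0 < m) (hl : 0 < l) (i : Fin n) :
    treatProb μ Z i = (m : ℝ) / n := by
  have hs : MeasurableSet {ω | Z ω i = true} :=
    ((measurable_pi_apply i).comp hZ) (measurableSet_singleton true)
  have h1 := h.integral_eq hZ (fun z => if z i = true then 1 else 0)
  rw [crExpect_arm hn hm hl i true] at h1
  unfold treatProb
  rw [← integral_indicator_one hs]
  simp only [armProb, if_true] at h1
  rw [← h1]
  congr 1
  funext ω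
  simp [Set.indicator_apply]

theorem IsCompleteRandomization.ae_sum_eq (h : IsCompleteRandomization μ Z m) :
    ∀ᵐ ω ∂μ, ∑ i, (Z ω i).toNat = m := by
  have h1 : ∀ᵐ ω ∂μ, ∀ z : Assignment n, ∑ i, (z i).toNat ≠ m → Z ω ≠ z := by
    rw [ae_all_iff]
    intro z
    by_cases hz : ∑ i, (z i).toNat = m
    · simp [hz]
    · have h2 := h z
      rw [if_neg hz, measureReal_eq_zero_iff] at h2
      filter_upwards [measure_eq_zero_iff_ae_notMem.mp h2] with ω hω _ using hω
  filter_upwards [h1] with ω hω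
  by_contra hne
  exact hω (Z ω) hne rfl

theorem IsCompleteRandomization.hajekEst_ae_eq (h : IsCompleteRandomization μ Z m)
    (hZ : Measurable Z) (hn : m + l = n) (hm : 0 < m) (hl : 0 < l) (y : Outcomes n) :
    ∀ᵐ ω ∂μ, hajekEst μ Z y ω = htEst μ Z y ω := by
  filter_upwards [h.ae_sum_eq] with ω hω
  have hm0 : (0 : ℝ) < m := by exact_mod_cast hm
  have hl0 : (0 : ℝ) < l := by exact_mod_cast hl
  have hnl : (n : ℝ) = m + l := by exact_mod_cast hn.symm
  have hsum : ∑ i, treated Z i ω = m := by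
    unfold treated
    exact_mod_cast hω
  have hp := h.treatProb_eq hZ hn hm hl
  have h1 : ∑ i, treated Z i ω / treatProb μ Z i = n := by
    simp_rw [hp]
    rw [← Finset.sum_div, hsum]
    field_simp
  have h2 : ∑ i, (1 - treated Z i ω) / (1 - treatProb μ Z i) = n := by
    simp_rw [hp]
    rw [← Finset.sum_div, Finset.sum_sub_distrib, hsum]
    simp only [Finset.sum_const, Finset.card_univ, Fintype.card_fin, nsmul_eq_mul, mul_one]
    rw [hnl]
    field_simp
    simp [hl.ne']
  unfold hajekEst htEst
  rw [h1, h2]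
  ring

/-- Valid for every `ω`, since only the marginal probabilities and the expectation of the effect are
evaluated. -/
theorem IsCompleteRandomization.htEst_sub_eate (h : IsCompleteRandomization μ Z m)
    (hZ : Measurable Z) (hn : m + l = n) (hm : 0 < m) (hl : 0 < l) (y : Outcomes n) (ω : Ω) :
    htEst μ Z y ω - eate μ Z y = (1 / (n : ℝ)) * ∑ i, unitError m l y i (Z ω) := by
  have hm0 : (0 : ℝ) < m := by exact_mod_cast hm
  have hl0 : (0 : ℝ) < l := by exact_mod_cast hl
  have hnl : (n : ℝ) = m + l := by exact_mod_cast hn.symm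
  have hp := h.treatProb_eq hZ hn hm hl
  have hq : 1 - (m : ℝ) / n = l / n := by
    rw [hnl]; field_simp; ring
  unfold htEst eate
  rw [h.integral_eq hZ]
  unfold ate unitError
  rw [crExpect_const_mul, crExpect_sum]
  simp_rw [crExpect_sub, hp, hq]
  rw [← mul_sub, ← mul_sub, ← Finset.sum_sub_distrib, ← Finset.sum_sub_distrib]
  congr 1
  refine Finset.sum_congr rfl fun i _ => ?_
  unfold treated observed armProb
  cases Z ω i <;> simp

/-- Splitting at t = k turns a q-th moment bound into the second moment bound 2k² pointwise, in
place of Jensen's inequality. -/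
theorem sq_le_add_rpow {k q t : ℝ} (hk : 0 < k) (hq : 2 ≤ q) (ht : 0 ≤ t) :
    t ^ 2 ≤ k ^ 2 * (1 + t ^ q / k ^ q) := by
  rw [← Real.div_rpow ht hk.le]
  have h0 : 0 ≤ t / k := by positivity
  have h : (t / k) ^ 2 ≤ 1 + (t / k) ^ q := by
    rcases le_total (t / k) 1 with h1 | h1
    · have := pow_le_one₀ (n := 2) h0 h1
      have := Real.rpow_nonneg h0 q
      linarith
    · rw [← Real.rpow_two]
      have := Real.rpow_le_rpow_of_exponent_le h1 hq
      linarith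
  calc t ^ 2 = k ^ 2 * (t / k) ^ 2 := by field_simp
    _ ≤ _ := by gcongr

theorem le_add_rpow {k s t : ℝ} (hk : 0 < k) (hs : 1 ≤ s) (ht : 0 ≤ t) :
    t ≤ k * (1 + t ^ s / k ^ s) := by
  rw [← Real.div_rpow ht hk.le]
  have h0 : 0 ≤ t / k := by positivity
  have h : t / k ≤ 1 + (t / k) ^ s := by
    rcases le_total (t / k) 1 with h1 | h1
    · have := Real.rpow_nonneg h0 s
      linarith
    · have := Real.rpow_le_rpow_of_exponent_le h1 hs
      rw [Real.rpow_one] at this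
      linarith
  calc t = k * (t / k) := by field_simp
    _ ≤ _ := by gcongr

theorem Regular.crExpect_sq_le {k q s : ℝ} {y : Outcomes n} (hr : Regular μ Z y k q s)
    (hk : 0 < k) (hq : 2 ≤ q) (h : IsCompleteRandomization μ Z m) (hZ : Measurable Z)
    (hm : m ≤ n) (i : Fin n) : crExpect m (fun z => y i z ^ 2) ≤ 2 * k ^ 2 := by
  have h1 := hr.outcome i
  unfold observed at h1
  rw [h.integral_eq hZ (fun z => |y i z| ^ q)] at h1
  have h2 : crExpect m (fun z => y i z ^ 2)
      ≤ crExpect m (fun z => k ^ 2 * (1 + (k ^ q)⁻¹ * |y i z| ^ q)) := by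
    refine crExpect_mono fun z => ?_
    rw [← sq_abs, ← div_eq_inv_mul]
    exact sq_le_add_rpow hk hq (abs_nonneg _)
  rw [crExpect_const_mul, crExpect_add, crExpect_const hm, crExpect_const_mul] at h2
  have hkq : 0 < k ^ q := Real.rpow_pos_of_pos hk q
  have h3 : (k ^ q)⁻¹ * crExpect m (fun z => |y i z| ^ q) ≤ 1 := by
    rwa [inv_mul_le_iff₀ hkq, mul_one]
  nlinarith [sq_nonneg k]

theorem Regular.crExpect_abs_update_le {k q s : ℝ} {y : Outcomes n} (hr : Regular μ Z y k q s)
    (hk : 0 < k) (hs : 1 ≤ s) (h : IsCompleteRandomization μ Z m) (hZ : Measurable Z)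
    (hm : m ≤ n) (i : Fin n) (b : Bool) :
    crExpect m (fun z => |y i (Function.update z i b)|) ≤ 2 * k := by
  have h1 := hr.potential i b
  rw [h.integral_eq hZ (fun z => |y i (Function.update z i b)| ^ s)] at h1
  have h2 : crExpect m (fun z => |y i (Function.update z i b)|)
      ≤ crExpect m (fun z => k * (1 + (k ^ s)⁻¹ * |y i (Function.update z i b)| ^ s)) := by
    refine crExpect_mono fun z => ?_
    rw [← div_eq_inv_mul]
    exact le_add_rpow hk hs (abs_nonneg _)
  rw [crExpect_const_mul, crExpect_add, crExpect_const hm, crExpect_const_mul] at h2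
  have hks : 0 < k ^ s := Real.rpow_pos_of_pos hk s
  have h3 : (k ^ s)⁻¹ * crExpect m (fun z => |y i (Function.update z i b)| ^ s) ≤ 1 := by
    rwa [inv_mul_le_iff₀ hks, mul_one]
  nlinarith

theorem dAvg_nonneg (y : Outcomes n) : 0 ≤ dAvg y := by
  classical
  unfold dAvg
  exact mul_nonneg (by positivity) (Finset.sum_nonneg fun i _ => Finset.sum_nonneg fun j _ => by
    split_ifs <;> norm_num)

theorem cAvg_pos (hn : 0 < n) (y : Outcomes n) : 0 < cAvg y := by
  classical
  unfold cAvg interferenceCount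
  have hn' : (0 : ℝ) < n := by exact_mod_cast hn
  refine mul_pos (by positivity) (Finset.sum_pos (fun i _ => ?_) ⟨⟨0, hn⟩, Finset.mem_univ _⟩)
  refine Finset.sum_pos' (fun j _ => by split_ifs <;> norm_num) ⟨i, Finset.mem_univ _, ?_⟩
  rw [if_pos (show Interferes y i i from Or.inr rfl)]
  norm_num

/-- The rate of convergence of the estimators. -/
noncomputable def rate (y : Outcomes n) : ℝ :=
  (n : ℝ) ^ (-(1 / 2) : ℝ) * dAvg y ^ (1 / 2 : ℝ) + (n : ℝ) ^ (-(1 / 2) : ℝ) * cAvg y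

/-- Strict positivity, due to each unit interfering with itself, lets the rate serve as a threshold
in Markov's inequality. -/
theorem rate_pos (hn : 0 < n) (y : Outcomes n) : 0 < rate y := by
  have hn' : (0 : ℝ) < n := by exact_mod_cast hn
  have := cAvg_pos hn y
  have := Real.rpow_nonneg (dAvg_nonneg y) (1 / 2)
  unfold rate
  positivity

theorem add_le_rate_sq (hn : 0 < n) (y : Outcomes n) :
    dAvg y / n + cAvg y ^ 2 / n ≤ rate y ^ 2 := by
  have hn' : (0 : ℝ) < n := by exact_mod_cast hn
  have hc := cAvg_pos hn y
  have hd := dAvg_nonneg y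
  unfold rate
  rw [Real.rpow_neg hn'.le, ← Real.sqrt_eq_rpow, ← Real.sqrt_eq_rpow]
  have h1 : (√(n : ℝ))⁻¹ ^ 2 = (n : ℝ)⁻¹ := by rw [inv_pow, Real.sq_sqrt hn'.le]
  have h2 : √(dAvg y) ^ 2 = dAvg y := Real.sq_sqrt hd
  have h3 : 0 ≤ (√(n : ℝ))⁻¹ * √(dAvg y) * ((√(n : ℝ))⁻¹ * cAvg y) := by positivity
  calc _ = (√(n : ℝ))⁻¹ ^ 2 * √(dAvg y) ^ 2 + (√(n : ℝ))⁻¹ ^ 2 * cAvg y ^ 2 := by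
        rw [h1, h2]; ring
    _ ≤ _ := by nlinarith

/-- Markov's inequality for the square of a function of the assignment. -/
theorem IsCompleteRandomization.measureReal_lt_abs_le (h : IsCompleteRandomization μ Z m)
    (hZ : Measurable Z) (F : Assignment n → ℝ) {t : ℝ} (ht : 0 < t) :
    μ.real {ω | t < |F (Z ω)|} ≤ crExpect m (fun z => F z ^ 2) / t ^ 2 := by
  have h1 := mul_meas_ge_le_integral_of_nonneg (μ := μ) (f := fun ω => F (Z ω) ^ 2)
    (Eventually.of_forall fun ω => sq_nonneg _)
    (integrable_comp_assignment hZ (fun z => F z ^ 2)) (t ^ 2)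
  rw [h.integral_eq hZ (fun z => F z ^ 2)] at h1
  rw [le_div_iff₀ (by positivity), mul_comm]
  refine le_trans (mul_le_mul_of_nonneg_left (measureReal_mono fun ω hω => ?_) (by positivity)) h1
  have hω' : t < |F (Z ω)| := hω
  change t ^ 2 ≤ F (Z ω) ^ 2
  rw [← sq_abs (F (Z ω))]
  gcongr

end Transfer

/-! ### Stochastic order and the vanishing rate -/

section Order

variable {Ω : ℕ → Type*} [∀ n, MeasurableSpace (Ω n)] {μ : ∀ n, Measure (Ω n)}

theorem IsBigOInProb.tendstoZeroInProb [∀ n, IsProbabilityMeasure (μ n)] {X : ∀ n, Ω n → ℝ}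
    {a : ℕ → ℝ} (h : IsBigOInProb μ X a) (ha : Tendsto a atTop (𝓝 0)) : TendstoZeroInProb μ X := by
  intro ε hε
  rw [Metric.tendsto_nhds]
  intro η hη
  obtain ⟨M, hM, hev⟩ := h (η / 2) (by positivity)
  have hMa : ∀ᶠ n in atTop, M * a n < ε := by
    have := ha.const_mul M
    rw [mul_zero] at this
    exact this.eventually_lt_const hε
  filter_upwards [hev, hMa] with n h1 h2
  rw [Real.dist_eq, sub_zero, abs_of_nonneg measureReal_nonneg]
  calc _ ≤ (μ n).real {ω | M * a n < |X n ω|} :=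
        measureReal_mono fun ω (hω : ε ≤ |X n ω|) => h2.trans_le hω
    _ ≤ η / 2 := h1
    _ < η := by linarith

theorem IsBigOInProb.congr_ae {X Y : ∀ n, Ω n → ℝ} {a : ℕ → ℝ} (h : IsBigOInProb μ X a)
    (hXY : ∀ᶠ n in atTop, X n =ᵐ[μ n] Y n) : IsBigOInProb μ Y a := by
  intro ε hε
  obtain ⟨M, hM, hev⟩ := h ε hε
  refine ⟨M, hM, ?_⟩
  filter_upwards [hev, hXY] with n h1 h2
  refine le_of_eq_of_le (measureReal_congr ?_) h1
  filter_upwards [h2] with ω hω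
  change (M * a n < |Y n ω|) = (M * a n < |X n ω|)
  rw [hω]

theorem tendsto_rate {y : ∀ n, Outcomes n}
    (hd : (fun n => dAvg (y n)) =o[atTop] (fun n : ℕ => (n : ℝ)))
    (hc : (fun n => cAvg (y n)) =o[atTop] (fun n : ℕ => (n : ℝ) ^ (1 / 2 : ℝ))) :
    Tendsto (fun n => rate (y n)) atTop (𝓝 0) := by
  have h1 := (hd.tendsto_div_nhds_zero).rpow_const (p := 1 / 2) (Or.inr (by norm_num))
  have h2 := hc.tendsto_div_nhds_zero
  rw [Real.zero_rpow (by norm_num)] at h1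
  have h3 := h1.add h2
  rw [add_zero] at h3
  refine h3.congr fun n => ?_
  unfold rate
  rw [Real.div_rpow (dAvg_nonneg _) (by positivity), Real.rpow_neg (by positivity)]
  ring

end Order

end Interference
-- The main theorem
theorem proposition3
    {Ω : ℕ → Type*} [∀ n, MeasurableSpace (Ω n)]
    (μ : ∀ n, Measure (Ω n)) [∀ n, IsProbabilityMeasure (μ n)]
    (Z : ∀ n, Ω n → Interference.Assignment n) (hZ : ∀ n, Measurable (Z n))
    (y : ∀ n, Interference.Outcomes n)
    -- complete randomization with `m = ⌊p n⌋`
    (p : ℝ) (hp0 : 0 < p) (hp1 : p < 1)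
    (hdesign : ∀ n : ℕ, Interference.IsCompleteRandomization (μ n) (Z n) ⌊p * (n : ℝ)⌋₊)
    -- regularity conditions
    (k q s : ℝ) (hk : 0 < k) (hq : 2 ≤ q) (hs : 1 ≤ s)
    (hreg : ∀ᶠ n in atTop, Interference.Regular (μ n) (Z n) (y n) k q s)
    -- restricted interference
    (hd : (fun n => Interference.dAvg (y n)) =o[atTop] (fun n : ℕ => (n : ℝ)))
    (hc : (fun n => Interference.cAvg (y n)) =o[atTop] (fun n : ℕ => (n : ℝ) ^ (1 / 2 : ℝ))) :
    -- the estimators coincide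
    (∀ n : ℕ, 0 < ⌊p * (n : ℝ)⌋₊ → ∀ᵐ ω ∂(μ n),
      Interference.hajekEst (μ n) (Z n) (y n) ω = Interference.htEst (μ n) (Z n) (y n) ω) ∧
    -- consistency
    Interference.TendstoZeroInProb μ
      (fun n ω => Interference.htEst (μ n) (Z n) (y n) ω
        - Interference.eate (μ n) (Z n) (y n)) ∧
    Interference.TendstoZeroInProb μ
      (fun n ω => Interference.hajekEst (μ n) (Z n) (y n) ω
        - Interference.eate (μ n) (Z n) (y n)) ∧
    -- rates of convergence
    Interference.IsBigOInProb μ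
      (fun n ω => Interference.htEst (μ n) (Z n) (y n) ω
        - Interference.eate (μ n) (Z n) (y n))
      (fun n => (n : ℝ) ^ (-(1 / 2) : ℝ) * Interference.dAvg (y n) ^ (1 / 2 : ℝ)
        + (n : ℝ) ^ (-(1 / 2) : ℝ) * Interference.cAvg (y n)) ∧
    Interference.IsBigOInProb μ
      (fun n ω => Interference.hajekEst (μ n) (Z n) (y n) ω
        - Interference.eate (μ n) (Z n) (y n))
      (fun n => (n : ℝ) ^ (-(1 / 2) : ℝ) * Interference.dAvg (y n) ^ (1 / 2 : ℝ)
        + (n : ℝ) ^ (-(1 / 2) : ℝ) * Interference.cAvg (y n)) := by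
  have hmn : ∀ n : ℕ, 0 < n → ⌊p * (n : ℝ)⌋₊ < n := by
    intro n hn
    have hn' : (0 : ℝ) < n := by exact_mod_cast hn
    rw [Nat.floor_lt (by positivity)]
    exact mul_lt_of_lt_one_left hn' hp1
  have hpos : ∀ᶠ n : ℕ in atTop, 0 < ⌊p * (n : ℝ)⌋₊ := by
    have h := (tendsto_natCast_atTop_atTop (R := ℝ)).const_mul_atTop hp0
    filter_upwards [h.eventually_ge_atTop 1] with n hn
    exact Nat.floor_pos.mpr hn
  have hae : ∀ n : ℕ, 0 < ⌊p * (n : ℝ)⌋₊ → ∀ᵐ ω ∂(μ n),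
      Interference.hajekEst (μ n) (Z n) (y n) ω = Interference.htEst (μ n) (Z n) (y n) ω := by
    intro n hn
    have hn0 : 0 < n := by
      rcases Nat.eq_zero_or_pos n with rfl | h
      · simp at hn
      · exact h
    have hlt := hmn n hn0
    exact (hdesign n).hajekEst_ae_eq (hZ n) (l := n - ⌊p * (n : ℝ)⌋₊) (by omega) hn (by omega) _
  have hHT : Interference.IsBigOInProb μ
      (fun n ω => Interference.htEst (μ n) (Z n) (y n) ω
        - Interference.eate (μ n) (Z n) (y n)) (fun n => Interference.rate (y n)) := by
    intro ε hε
    obtain ⟨K, hK, hmse⟩ := Interference.exists_mse_le (c := k⁻¹) (V := 2 * k ^ 2) (κ := 2 * k)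
      (by positivity) (by positivity) (by positivity)
    -- With M² = K/ε, Markov's bound K·rate²/(M·rate)² is exactly `ε`.
    refine ⟨√(K / ε), by positivity, ?_⟩
    filter_upwards [hreg, hpos, eventually_gt_atTop 0] with n hr hm hn0
    have hlt := hmn n hn0
    have hdes := hdesign n
    set m := ⌊p * (n : ℝ)⌋₊
    obtain ⟨l, hl⟩ : ∃ l, m + l = n := ⟨n - m, by omega⟩
    have hl0 : 0 < l := by omega
    have hn' : (0 : ℝ) < n := by exact_mod_cast hn0
    have hml : (m : ℝ) + l = n := by exact_mod_cast hl
    -- As every treatment probability is m/n, one unit suffices to give n/k ≤ m and n/k ≤ l.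
    have hprob := hr.prob ⟨0, hn0⟩
    rw [hdes.treatProb_eq (hZ n) hl hm hl0, le_div_iff₀ hn', div_le_iff₀ hn', sub_mul,
      one_mul] at hprob
    have hb := hmse (y n) hn0 hl hprob.1 (by linarith)
      (hr.crExpect_sq_le hk hq hdes (hZ n) (by omega))
      (hr.crExpect_abs_update_le hk hs hdes (hZ n) (by omega))
    have hrate := Interference.rate_pos hn0 (y n)
    simp_rw [hdes.htEst_sub_eate (hZ n) hl hm hl0]
    refine (hdes.measureReal_lt_abs_le (hZ n)
      (fun z => (1 / (n : ℝ)) * ∑ i, Interference.unitError m l (y n) i z)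
      (by positivity)).trans ?_
    rw [div_le_iff₀ (by positivity), mul_pow, Real.sq_sqrt (by positivity)]
    refine hb.trans ((mul_le_mul_of_nonneg_left (Interference.add_le_rate_sq hn0 _) hK.le).trans
      (le_of_eq ?_))
    field_simp
  have hHA : Interference.IsBigOInProb μ
      (fun n ω => Interference.hajekEst (μ n) (Z n) (y n) ω
        - Interference.eate (μ n) (Z n) (y n)) (fun n => Interference.rate (y n)) := by
    refine hHT.congr_ae ?_
    filter_upwards [hpos] with n hn
    filter_upwards [hae n hn] with ω hω
    rw [hω]
  have hrate := Interference.tendsto_rate hd hc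
  exact ⟨hae, hHT.tendstoZeroInProb hrate, hHA.tendstoZeroInProb hrate, hHT, hHA⟩
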